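/- We work in the category of well-pointed compactly generated Hausdorff spaces (the inclusion of the base point has the homotopy extension property) and base-point-preserving continuous maps; products carry the compactly generated topology, and homotopies preserve the base point. A map is null-homotopic if it is homotopic to the constant map at the base point. For maps $f\colon A\to C$ and $g\colon B\to C$ let $L=\{(a,\gamma,b)\in A\times C^{[0,1]}\times B : \gamma(0)=f(a),\ \gamma(1)=g(b)\}$ be the standard homotopy pullback. The \emph{join} of $f$ and $g$ is the homotopy pushout (the reduced double mapping cylinder) of the two projections $A\leftarrow L\to B$, together with the map to $C$ that is $f$ on $A$, $g$ on $B$, and sends the point $((a,\gamma,b),t)$ of the cylinder to $\gamma(t)$. The homotopy cofibre of a map $q\colon X\to Y$ is the reduced mapping cone $C_q$, with its inclusion $Y\to C_q$. Let $p\colon E\to B$ be a map. The $n$-sectional fatwedge $\kappa_n\colon T^n(p)\to B^{n+1}$ is defined inductively: $\kappa_0=p\colon E\to B$, and for $n\ge 1$ the map $\kappa_n$ is the join of $\kappa_{n-1}\times \mathrm{id}_B\colon T^{n-1}(p)\times B\to B^{n+1}$ and $\mathrm{id}_{B^n}\times p\colon B^n\times E\to B^{n+1}$. Let $l_n\colon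 B^{n+1}\to C_{\kappa_n}$ be the inclusion in the homotopy cofibre of $\kappa_n$, and $\Delta_{n+1}\colon B\to B^{n+1}$ the diagonal. The \emph{weak sectional category} $\mathrm{wsecat}(p)$ is the least integer $n\ge 0$ such that $l_n\circ\Delta_{n+1}\colon B\to C_{\kappa_n}$ is null-homotopic, or $\infty$ if there is no such $n$. For a space $X$ let $X^{[n+1]}$ be the $(n+1)$-fold smash product, that is, the quotient of $X^{n+1}$ by the subspace of points with at least one coordinate at the base point; let $\bar\Delta_{n+1}\colon X\to X^{n+1}\to X^{[n+1]}$ be the reduced diagonal, and for a map $f\colon X\to Y$ let $f^{[n+1]}\colon X^{[n+1]}\to Y^{[n+1]}$ be the induced map. \textbf{Proposition.} Let $p\colon E\to B$ be a map, let $C_p$ be its homotopy cofibre, and let $j\colon B\to C_p$ be the induced map. Then for every integer $n\ge 0$, $\mathrm{wsecat}(p)\le n$ if and only if the composite $$B\xrightarrow{\ \bar\Delta_{n+1}\ }B^{[n+1]}\xrightarrow{\ j^{[n+1]}\ }C_p^{[n+1]}$$ is null-homotopic. -/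

import Mathlib

universe u

noncomputable section

namespace WeakSecat

/-- A pointed topological space. -/
structure PtdSpace : Type (u + 1) where
  /-- the underlying type -/
  carrier : Type u
  /-- the topology -/
  [top : TopologicalSpace carrier]
  /-- the base point -/
  pt : carrier

instance : CoeSort PtdSpace.{u} (Type u) := ⟨PtdSpace.carrier⟩

instance (X : PtdSpace.{u}) : TopologicalSpace X := X.top

/-- The objects of the ambient category: compactly generated Hausdorff spaces whose base point
inclusion has the homotopy extension property. (For Hausdorff spaces, `CompactlyCoherentSpace` is
the usual notion of being compactly generated.) -/
class WellPointedCGH (X : PtdSpace.{u}) : Prop extends T2Space X, CompactlyCoherentSpace X where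
  /-- the inclusion of the base point is a (Hurewicz) cofibration -/
  hep : ∀ (Y : Type u) [TopologicalSpace Y] (f : C(X, Y)) (γ : C(unitInterval, Y)),
    γ 0 = f X.pt →
      ∃ H : C(X × unitInterval, Y), (∀ x, H (x, 0) = f x) ∧ ∀ t, H (X.pt, t) = γ t

/-- Pointed continuous maps. -/
structure PtdMap (X Y : PtdSpace.{u}) where
  /-- the underlying continuous map -/
  toMap : C(X, Y)
  map_pt : toMap X.pt = Y.pt

instance (X Y : PtdSpace.{u}) : CoeFun (PtdMap X Y) (fun _ => X → Y) := ⟨fun f => f.toMap⟩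

namespace PtdMap

variable {X Y Z : PtdSpace.{u}}

/-- The identity. -/
def id (X : PtdSpace.{u}) : PtdMap X X := ⟨ContinuousMap.id X, rfl⟩

/-- Composition `g ∘ f`. -/
def comp (g : PtdMap Y Z) (f : PtdMap X Y) : PtdMap X Z :=
  ⟨g.toMap.comp f.toMap, by simp [f.map_pt, g.map_pt]⟩

/-- A pointed map is null-homotopic if it is homotopic to the constant map at the base point,
through a homotopy that fixes the base point. -/
def NullHomotopic (f : PtdMap X Y) : Prop :=
  f.toMap.HomotopicRel (ContinuousMap.const X Y.pt) {X.pt}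

end PtdMap

/-- The one-point space. -/
def point : PtdSpace.{u} := ⟨PUnit.{u + 1}, PUnit.unit⟩

/-- The only map to the one-point space. -/
def toPoint (X : PtdSpace.{u}) : PtdMap X point := ⟨ContinuousMap.const X PUnit.unit, rfl⟩

/-! ### Products in compactly generated spaces -/

section Products

variable {X X' Y Y' : PtdSpace.{u}}

/-- The product of compactly generated spaces: the k-ification of the usual product. -/
def prod (X Y : PtdSpace.{u}) : PtdSpace.{u} :=
  ⟨CompactCoherentification (X × Y), CompactCoherentification.mk _ (X.pt, Y.pt)⟩

/-- The two coordinates of a point of the product, as a continuous map to the usual product. -/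
def prod.coords (X Y : PtdSpace.{u}) : C(prod X Y, X × Y) :=
  ⟨(CompactCoherentification.mk (X × Y)).symm, CompactCoherentification.continuous_mk_symm⟩

theorem prod.coords_pt (X Y : PtdSpace.{u}) : prod.coords X Y (prod X Y).pt = (X.pt, Y.pt) :=
  rfl

theorem prod.coords_injective (X Y : PtdSpace.{u}) : Function.Injective (prod.coords X Y) :=
  (CompactCoherentification.mk (X × Y)).symm.injective

/-- The product `f × g` of two maps. -/
def prodMap (f : PtdMap X X') (g : PtdMap Y Y') : PtdMap (prod X Y) (prod X' Y') where
  toMap :=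
    { toFun := CompactCoherentification.map (Prod.map f g)
      continuous_toFun := CompactCoherentification.continuous_map_of_continuous
        (X := X × Y) (Y := X' × Y') (f.toMap.continuous.prodMap g.toMap.continuous) }
  map_pt := prod.coords_injective X' Y' (Prod.ext f.map_pt g.map_pt)

theorem prod.coords_prodMap (f : PtdMap X X') (g : PtdMap Y Y') (z : prod X Y) :
    prod.coords X' Y' (prodMap f g z) = (f (prod.coords X Y z).1, g (prod.coords X Y z).2) :=
  rfl

/-- The map `(f, g) : X → Y × Y'` on a compactly generated space `X`. -/
def pair [CompactlyCoherentSpace X] (f : PtdMap X Y) (g : PtdMap X Y') :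
    PtdMap X (prod Y Y') where
  toMap :=
    { toFun := fun x => CompactCoherentification.mk (Y × Y') (f x, g x)
      continuous_toFun := (CompactCoherentification.continuous_map_of_continuous
        (f.toMap.continuous.prodMk g.toMap.continuous)).comp
          (CompactCoherentification.continuous_mk (X := X)) }
  map_pt := prod.coords_injective Y Y' (Prod.ext f.map_pt g.map_pt)

theorem prod.coords_pair [CompactlyCoherentSpace X] (f : PtdMap X Y) (g : PtdMap X Y') (x : X) :
    prod.coords Y Y' (pair f g x) = (f x, g x) :=
  rfl

/-- `pow X n` is the `(n + 1)`-fold product `X × ⋯ × X`. -/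
def pow (X : PtdSpace.{u}) : ℕ → PtdSpace.{u}
  | 0 => X
  | n + 1 => prod (pow X n) X

/-- The map `f × ⋯ × f` between `(n + 1)`-fold products. -/
def powMap (f : PtdMap X Y) : (n : ℕ) → PtdMap (pow X n) (pow Y n)
  | 0 => f
  | n + 1 => prodMap (powMap f n) f

/-- The diagonal map `x ↦ (x, …, x)` into the `(n + 1)`-fold product. -/
def diag (X : PtdSpace.{u}) [CompactlyCoherentSpace X] : (n : ℕ) → PtdMap X (pow X n)
  | 0 => PtdMap.id X
  | n + 1 => pair (diag X n) (PtdMap.id X)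

end Products

/-! ### Smash powers -/

section Smash

variable {X Y : PtdSpace.{u}}

/-- The points of the `(n + 1)`-fold product with at least one coordinate at the base point. -/
def fatWedge (X : PtdSpace.{u}) : (n : ℕ) → Set (pow X n)
  | 0 => {x : X | x = X.pt}
  | n + 1 => {z : prod (pow X n) X | (prod.coords _ _ z).1 ∈ fatWedge X n ∨
      (prod.coords _ _ z).2 = X.pt}

/-- The relation that identifies all points of the fat wedge. -/
def smashRel (X : PtdSpace.{u}) (n : ℕ) (a b : pow X n) : Prop :=
  a ∈ fatWedge X n ∧ b ∈ fatWedge X n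

/-- The `(n + 1)`-fold smash product: the `(n + 1)`-fold product modulo the fat wedge. -/
def smash (X : PtdSpace.{u}) (n : ℕ) : PtdSpace.{u} :=
  ⟨Quot (smashRel X n), Quot.mk _ (pow X n).pt⟩

/-- The projection from the `(n + 1)`-fold product to the `(n + 1)`-fold smash product. -/
def smashProj (X : PtdSpace.{u}) (n : ℕ) : PtdMap (pow X n) (smash X n) :=
  ⟨⟨Quot.mk _, continuous_quot_mk⟩, rfl⟩

theorem powMap_mem_fatWedge (f : PtdMap X Y) :
    ∀ (n : ℕ) (a : pow X n), a ∈ fatWedge X n → powMap f n a ∈ fatWedge Y n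
  | 0, a, ha => by
      change f a = Y.pt
      rw [show a = X.pt from ha]
      exact f.map_pt
  | n + 1, a, ha => by
      rcases ha with ha | ha
      · exact Or.inl (powMap_mem_fatWedge f n _ ha)
      · exact Or.inr ((congrArg f.toMap ha).trans f.map_pt)

/-- The map induced by `f` between `(n + 1)`-fold smash products. -/
def smashMap (f : PtdMap X Y) (n : ℕ) : PtdMap (smash X n) (smash Y n) where
  toMap := ⟨Quot.map (powMap f n) fun a b h =>
      ⟨powMap_mem_fatWedge f n a h.1, powMap_mem_fatWedge f n b h.2⟩,
    continuous_quot_lift _ (continuous_quot_mk.comp (powMap f n).toMap.continuous)⟩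
  map_pt := congrArg (Quot.mk _) (powMap f n).map_pt

/-- The reduced diagonal from `X` to its `(n + 1)`-fold smash product. -/
def reducedDiag (X : PtdSpace.{u}) [CompactlyCoherentSpace X] (n : ℕ) : PtdMap X (smash X n) :=
  (smashProj X n).comp (diag X n)

end Smash

/-! ### Homotopy pullbacks, homotopy pushouts and joins -/

section HomotopyLimits

variable {A B C P : PtdSpace.{u}}

/-- The standard homotopy pullback of `f : A → C` and `g : B → C`: the space of triples
`(a, γ, b)` with `γ` a path in `C` from `f a` to `g b`. -/
def hPullback (f : PtdMap A C) (g : PtdMap B C) : PtdSpace.{u} :=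
  ⟨CompactCoherentification
      {w : A × C(unitInterval, C) × B // w.2.1 0 = f w.1 ∧ w.2.1 1 = g w.2.2},
    CompactCoherentification.mk _
      ⟨(A.pt, ContinuousMap.const _ C.pt, B.pt), f.map_pt.symm, g.map_pt.symm⟩⟩

/-- The underlying triple `(a, γ, b)` of a point of the homotopy pullback. -/
def hPullback.triple (f : PtdMap A C) (g : PtdMap B C) :
    C(hPullback f g, {w : A × C(unitInterval, C) × B // w.2.1 0 = f w.1 ∧ w.2.1 1 = g w.2.2}) :=
  ⟨(CompactCoherentification.mk _).symm, CompactCoherentification.continuous_mk_symm⟩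

theorem hPullback.triple_pt (f : PtdMap A C) (g : PtdMap B C) :
    (hPullback.triple f g (hPullback f g).pt).1 =
      (A.pt, ContinuousMap.const _ C.pt, B.pt) := rfl

/-- The projection `(a, γ, b) ↦ a`. -/
def hPullback.fst (f : PtdMap A C) (g : PtdMap B C) : PtdMap (hPullback f g) A where
  toMap := ⟨fun w => (hPullback.triple f g w).1.1, by fun_prop⟩
  map_pt := rfl

/-- The projection `(a, γ, b) ↦ b`. -/
def hPullback.snd (f : PtdMap A C) (g : PtdMap B C) : PtdMap (hPullback f g) B where
  toMap := ⟨fun w => (hPullback.triple f g w).1.2.2, by fun_prop⟩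
  map_pt := rfl

/-- The identifications in the disjoint union of `A`, `P × [0, 1]` and `B` that define the
reduced double mapping cylinder of `f : P → A` and `g : P → B`. -/
inductive hPushoutRel (f : PtdMap P A) (g : PtdMap P B) :
    A ⊕ (P × unitInterval) ⊕ B → A ⊕ (P × unitInterval) ⊕ B → Prop
  | left (x : P) : hPushoutRel f g (Sum.inr (Sum.inl (x, 0))) (Sum.inl (f x))
  | right (x : P) : hPushoutRel f g (Sum.inr (Sum.inl (x, 1))) (Sum.inr (Sum.inr (g x)))
  | base (t : unitInterval) :
      hPushoutRel f g (Sum.inr (Sum.inl (P.pt, t))) (Sum.inr (Sum.inl (P.pt, 0)))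

/-- The standard homotopy pushout of `f : P → A` and `g : P → B` in pointed spaces: the reduced
double mapping cylinder. -/
def hPushout (f : PtdMap P A) (g : PtdMap P B) : PtdSpace.{u} :=
  ⟨Quot (hPushoutRel f g), Quot.mk _ (Sum.inl A.pt)⟩

/-- The inclusion of `A` in the homotopy pushout of `f : P → A` and `g : P → B`. -/
def hPushout.inl (f : PtdMap P A) (g : PtdMap P B) : PtdMap A (hPushout f g) :=
  ⟨⟨fun a => Quot.mk _ (Sum.inl a), continuous_quot_mk.comp continuous_inl⟩, rfl⟩

/-- The co-whisker map from the homotopy pushout of `f : P → A` and `g : P → B` to `C` that is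
`u` on `A`, `v` on `B`, and the pointed homotopy `H` from `u ∘ f` to `v ∘ g` on the cylinder. -/
def hPushout.desc {f : PtdMap P A} {g : PtdMap P B} (u : PtdMap A C) (v : PtdMap B C)
    (H : C(P × unitInterval, C)) (h0 : ∀ x, H (x, 0) = u (f x)) (h1 : ∀ x, H (x, 1) = v (g x))
    (hpt : ∀ t, H (P.pt, t) = C.pt) : PtdMap (hPushout f g) C where
  toMap := ⟨Quot.lift (Sum.elim u (Sum.elim H v)) (by
      rintro _ _ (x | x | t)
      · exact h0 x
      · exact h1 x
      · exact (hpt t).trans (hpt 0).symm),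
    continuous_quot_lift _
      (u.toMap.continuous.sumElim (H.continuous.sumElim v.toMap.continuous))⟩
  map_pt := u.map_pt

/-- The join of `f : A → C` and `g : B → C`: the homotopy pushout of the two projections of the
homotopy pullback of `f` and `g`. -/
def join (f : PtdMap A C) (g : PtdMap B C) : PtdSpace.{u} :=
  hPushout (hPullback.fst f g) (hPullback.snd f g)

/-- The co-whisker map from the join of `f` and `g` to `C`; it sends the point
`((a, γ, b), t)` of the cylinder to `γ t`. -/
def joinMap (f : PtdMap A C) (g : PtdMap B C) : PtdMap (join f g) C :=
  hPushout.desc f g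
    ⟨fun x => (hPullback.triple f g x.1).1.2.1 x.2, by fun_prop⟩
    (fun x => (hPullback.triple f g x).2.1)
    (fun x => (hPullback.triple f g x).2.2)
    (fun _ => rfl)

end HomotopyLimits

section Invariants

variable {E B : PtdSpace.{u}}

/-- The homotopy cofibre of `p : E → B`: the homotopy pushout of `B ← E → *`, which is the reduced
mapping cone. -/
def cofibre (p : PtdMap E B) : PtdSpace.{u} := hPushout p (toPoint E)

/-- The induced map from `B` to the homotopy cofibre of `p : E → B`. -/
def cofibreIncl (p : PtdMap E B) : PtdMap B (cofibre p) := hPushout.inl p (toPoint E)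

/-- The `n`-sectional fat wedge `κₙ : Tⁿ(p) → Bⁿ⁺¹`: `κ₀ = p`, and `κₙ₊₁` is the join map of
`κₙ × id : Tⁿ(p) × B → Bⁿ⁺¹ × B` and `id × p : Bⁿ⁺¹ × E → Bⁿ⁺¹ × B`. -/
def sectionalFatWedge (p : PtdMap E B) : (n : ℕ) → (T : PtdSpace.{u}) × PtdMap T (pow B n)
  | 0 => ⟨E, p⟩
  | n + 1 =>
    ⟨join (prodMap (sectionalFatWedge p n).2 (PtdMap.id B)) (prodMap (PtdMap.id (pow B n)) p),
      joinMap (prodMap (sectionalFatWedge p n).2 (PtdMap.id B))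
        (prodMap (PtdMap.id (pow B n)) p)⟩

/-- The weak sectional category of `p : E → B`: the least `n` such that the composite of the
diagonal `B → Bⁿ⁺¹` and the map from `Bⁿ⁺¹` to the homotopy cofibre of `κₙ` is null-homotopic,
and `∞` if there is none. -/
def wsecat [CompactlyCoherentSpace B] (p : PtdMap E B) : ℕ∞ :=
  sInf {m : ℕ∞ | ∃ n : ℕ, m = n ∧
    ((cofibreIncl (sectionalFatWedge p n).2).comp (diag B n)).NullHomotopic}

end Invariants

end WeakSecat

end

/-! Up to homotopy, the cofibre of `κₙ` and the smash power of `C_p` receive compatible maps from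
`B`, and maps in both directions under `B` are enough; no equivalence between them is needed. From
the cofibre to the smash power: the cone coordinate of `C_p` contracts `p`, and inductively a join
can be pushed until one of its coordinates is fully contracted. So `jⁿ⁺¹ ∘ κₙ` deforms into the fat
wedge (`exists_sectionalFatWedge_deformation`), and the composite to the smash power extends over
the cofibre. From the smash power to the cofibre: with `C_p` replaced by the unreduced mapping cone
based at its vertex, the pair (cone, vertex) has explicit products. A formula (`coneProd`) sends a
product of two cones to the cone of the join, and sends every point with a coordinate at a vertex to
the vertex. Iteration gives a map from the smash power of `cone p` to the cone of `κₙ`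
(`exists_pow_cone_to_cone`). Well-pointedness links the two models: `C_p` maps to `cone p` by a
pointed map compatible up to free homotopy with the inclusions of `B` (`exists_cofibre_to_cone`),
and on a well-pointed source a free contraction to the base point can be made pointed
(`homotopicRel_const_of_homotopic`). Finally, a least `m ≤ n` must be raised to `n`. This is done in
the smash powers of the unreduced cone, which is Hausdorff (`homotopic_const_reducedDiag_of_le`). -/

noncomputable section

namespace WeakSecat

open Topology unitInterval

/-! ### Compactly generated topology: products, sums and continuity tests. -/

section Topology

variable {X Y Z : Type*} [TopologicalSpace X] [TopologicalSpace Y] [TopologicalSpace Z]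

theorem compactlyCoherentSpace_of_isQuotientMap [CompactlyCoherentSpace X] {q : X → Y}
    (hq : IsQuotientMap q) : CompactlyCoherentSpace Y := by
  refine .of_isOpen fun A hA => hq.isOpen_preimage.1 (CompactlyCoherentSpace.isOpen_iff.2 ?_)
  intro K hK
  have h := (hA (q '' K) (hK.image hq.continuous)).preimage
    (hq.continuous.restrict (Set.mapsTo_image q K))
  exact h

instance {X Y : Type u} [TopologicalSpace X] [TopologicalSpace Y] [CompactlyCoherentSpace X]
    [CompactlyCoherentSpace Y] : CompactlyCoherentSpace (X ⊕ Y) := by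
  refine .of_isOpen_forall_compactSpace fun s hs => isOpen_sum_iff.2 ⟨?_, ?_⟩
  · exact (CompactlyCoherentSpace.isOpen_iff_forall_compactSpace _).2 fun K _ _ f hf =>
      hs K _ (continuous_inl.comp hf)
  · exact (CompactlyCoherentSpace.isOpen_iff_forall_compactSpace _).2 fun K _ _ f hf =>
      hs K _ (continuous_inr.comp hf)

/-- A tube argument: the slice over `x` is open, so it contains a compact neighbourhood `N` of `y`.
The set of `x'` whose whole slice over `N` lies in `A` is open because, on each compact `K`, its
complement is the image of a closed set under the projection along the compact `N`. -/
instance [CompactlyCoherentSpace X] [LocallyCompactSpace Y] :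
    CompactlyCoherentSpace (X × Y) := by
  refine .of_isOpen fun A hA => isOpen_iff_mem_nhds.2 ?_
  rintro ⟨x, y⟩ hxy
  have hslice : IsOpen {y' | (x, y') ∈ A} := by
    refine CompactlyCoherentSpace.isOpen_iff.2 fun K hK => ?_
    have h := (hA _ ((isCompact_singleton (x := x)).prod hK)).preimage
      (f := fun k : K => (⟨(x, k), rfl, k.2⟩ : ({x} ×ˢ K : Set (X × Y)))) (by fun_prop)
    exact h
  obtain ⟨N, hN, hNA, hNc⟩ := local_compact_nhds (hslice.mem_nhds hxy)
  have hV : IsOpen {x' | ∀ y' : N, (x', (y' : Y)) ∈ A} := by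
    refine CompactlyCoherentSpace.isOpen_iff.2 fun K hK => ?_
    have : CompactSpace N := isCompact_iff_compactSpace.1 hNc
    have h := (hA _ (hK.prod hNc)).preimage
      (f := fun k : K × N => (⟨(k.1, k.2), k.1.2, k.2.2⟩ : (K ×ˢ N : Set (X × Y))))
      (by fun_prop)
    have hq := (isClosedMap_fst_of_compactSpace (X := K) (Y := N)) _ h.isClosed_compl
    convert hq.isOpen_compl
    ext k
    simp
  filter_upwards [prod_mem_nhds (hV.mem_nhds fun y' => hNA y'.2) hN] with z hz
  exact hz.1 ⟨z.2, hz.2⟩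

instance [LocallyCompactSpace X] [CompactlyCoherentSpace Y] :
    CompactlyCoherentSpace (X × Y) :=
  compactlyCoherentSpace_of_isQuotientMap (Homeomorph.prodComm Y X).isQuotientMap

theorem continuous_mk_of_continuous [CompactlyCoherentSpace X] {f : X → Y} (hf : Continuous f) :
    Continuous fun x => CompactCoherentification.mk Y (f x) :=
  (CompactCoherentification.continuous_map_of_continuous hf).comp
    CompactCoherentification.continuous_mk

/-- A map out of a product in compactly generated spaces is continuous if it is continuous on
`K × Y` for all compact subsets `K` of the first factor. -/
theorem continuous_of_forall_compact_left {g : CompactCoherentification (X × Y) → Z}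
    (h : ∀ K : Set X, IsCompact K →
      Continuous fun q : K × Y => g (CompactCoherentification.mk _ ((q.1 : X), q.2))) :
    Continuous g := by
  refine CompactCoherentification.continuous_dom_iff.2 fun K hK => ?_
  rw [continuousOn_iff_continuous_domRestrict]
  exact (h (Prod.fst '' K) (hK.image continuous_fst)).comp
    (f := fun k : K => ((⟨k.1.1, k.1, k.2, rfl⟩ : Prod.fst '' K), k.1.2)) (by fun_prop)

theorem continuous_of_forall_compact_right {g : CompactCoherentification (X × Y) → Z}
    (h : ∀ K : Set Y, IsCompact K →
      Continuous fun q : X × K => g (CompactCoherentification.mk _ (q.1, (q.2 : Y)))) :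
    Continuous g := by
  refine CompactCoherentification.continuous_dom_iff.2 fun K hK => ?_
  rw [continuousOn_iff_continuous_domRestrict]
  exact (h (Prod.snd '' K) (hK.image continuous_snd)).comp
    (f := fun k : K => (k.1.1, (⟨k.1.2, k.1, k.2, rfl⟩ : Prod.snd '' K))) (by fun_prop)

theorem continuous_of_sum_prod {W : Type*} [TopologicalSpace W] {g : (X ⊕ Y) × Z → W}
    (hl : Continuous fun q : X × Z => g (Sum.inl q.1, q.2))
    (hr : Continuous fun q : Y × Z => g (Sum.inr q.1, q.2)) : Continuous g := by
  have h := (hl.sumElim hr).comp (Homeomorph.sumProdDistrib (X := X) (Y := Y) (Z := Z)).continuous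
  convert h using 1
  ext ⟨_ | _, z⟩ <;> rfl

/-- The projection of the real line to the unit interval. -/
def clamp : C(ℝ, I) := ⟨Set.projIcc 0 1 zero_le_one, continuous_projIcc⟩

theorem clamp_of_nonpos {t : ℝ} (h : t ≤ 0) : clamp t = 0 := Set.projIcc_of_le_left zero_le_one h

theorem clamp_of_one_le {t : ℝ} (h : 1 ≤ t) : clamp t = 1 := Set.projIcc_of_right_le zero_le_one h

end Topology

/-! ### From free to pointed null-homotopies. -/

section FreeHomotopy

/-- A pointed map on a well-pointed space that is freely homotopic to the constant map at the base
point is homotopic to it relative to the base point. -/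
theorem homotopicRel_const_of_homotopic {X : PtdSpace.{u}} [WellPointedCGH X] {Y : Type u}
    [TopologicalSpace Y] {f : C(X, Y)} {y : Y} (hf : f X.pt = y)
    (h : f.Homotopic (ContinuousMap.const X y)) :
    f.HomotopicRel (ContinuousMap.const X y) {X.pt} := by
  obtain ⟨H⟩ := h
  let ω : C(I, Y) := ⟨fun t => H (t, X.pt), by fun_prop⟩
  have hω0 : ω 0 = y := (H.apply_zero _).trans hf
  have hω1 : ω 1 = y := H.apply_one _
  -- Paths in `Y` whose end lies on the loop `ω` traced by the base point, with a record of where on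
  -- the loop. The extension property is applied to maps into `Z`, so that while the track of the
  -- base point is shrunk to a constant, all the tracks still end on `ω`.
  let Z : Type u := {w : C(I, Y) × I // w.1 1 = ω (σ w.2)}
  let c : C(X, C(I, Y)) := ContinuousMap.curry ⟨fun q : X × I => H (q.2, q.1), by fun_prop⟩
  let d : C(I, C(I, Y)) := ContinuousMap.curry
    ⟨fun q : I × I => ω (q.2 * σ q.1), by fun_prop⟩
  let F : C(X, Z) := ⟨fun x => ⟨(c x, 0), by simp [c, hω1]⟩, by fun_prop⟩
  let γ : C(I, Z) := ⟨fun s => ⟨(d s, s), by simp [d]⟩, by fun_prop⟩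
  obtain ⟨G, hG0, hG⟩ := WellPointedCGH.hep Z F γ (by
    refine Subtype.ext (Prod.ext ?_ rfl)
    ext t
    simp [F, γ, c, d, ω])
  let g : C(X × I, C(I, Y)) := ⟨fun q => (G q).1.1,
    continuous_fst.comp (continuous_subtype_val.comp G.continuous)⟩
  let τ : C(X × I, I) := ⟨fun q => (G q).1.2,
    continuous_snd.comp (continuous_subtype_val.comp G.continuous)⟩
  have hg0 : ∀ x t, g (x, 0) t = H (t, x) := fun x t => by
    change (G (x, 0)).1.1 t = _
    rw [hG0]; rfl
  have hpt : ∀ s t, g (X.pt, s) t = ω (t * σ s) := fun s t => by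
    change (G (X.pt, s)).1.1 t = _
    rw [hG]; rfl
  have hτ : τ (X.pt, 1) = 1 := by
    change (G (X.pt, 1)).1.2 = _
    rw [hG]; rfl
  have hend : ∀ x s, g (x, s) 1 = ω (σ (τ (x, s))) := fun x s => (G (x, s)).2
  let k₀ : C(X, Y) := ⟨fun x => g (x, 1) 0, by fun_prop⟩
  let k₁ : C(X, Y) := ⟨fun x => g (x, 1) 1, by fun_prop⟩
  have h₁ : f.HomotopicRel k₀ {X.pt} := ⟨{
    toFun q := g (q.2, q.1) 0
    -- At the base point every track `t ↦ ω (t * σ s)` starts at `ω 0 = y`, so moving the starting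
    -- points fixes the base point.
    continuous_toFun := by fun_prop
    map_zero_left x := by rw [hg0]; exact H.apply_zero x
    map_one_left x := rfl
    prop' t x hx := by
      rw [Set.mem_singleton_iff.1 hx]
      change g (X.pt, t) 0 = _
      rw [hpt, hf, zero_mul, hω0] }⟩
  -- At `s = 1` the track of the base point is constant, so running along the tracks is a pointed
  -- homotopy.
  have h₂ : k₀.HomotopicRel k₁ {X.pt} := ⟨{
    toFun q := g (q.2, 1) q.1
    continuous_toFun := by fun_prop
    map_zero_left x := rfl
    map_one_left x := rfl
    prop' t x hx := by
      rw [Set.mem_singleton_iff.1 hx]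
      change g (X.pt, 1) t = g (X.pt, 1) 0
      rw [hpt, hpt]; simp }⟩
  -- `k₁` factors through the parameter interval of `ω`, which is contracted to `0`; the base point
  -- already sits at parameter `σ 1 = 0`.
  have h₃ : k₁.HomotopicRel (ContinuousMap.const X y) {X.pt} := ⟨{
    toFun q := ω (σ (τ (q.2, 1)) * σ q.1)
    continuous_toFun := by fun_prop
    map_zero_left x := by simpa [k₁] using (hend x 1).symm
    map_one_left x := by simp [hω0]
    prop' t x hx := by
      rw [Set.mem_singleton_iff.1 hx]
      change ω (σ (τ (X.pt, 1)) * σ t) = g (X.pt, 1) 1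
      rw [hpt, hτ]; simp }⟩
  exact (h₁.trans h₂).trans h₃

end FreeHomotopy

/-! ### Deforming a join when both of its legs are contracted. -/

section JoinContraction

variable {A B C D P W X Y Z : PtdSpace.{u}}

instance (X Y : PtdSpace.{u}) : CompactlyCoherentSpace (prod X Y) :=
  inferInstanceAs (CompactlyCoherentSpace (CompactCoherentification (X × Y)))

instance (f : PtdMap A C) (g : PtdMap B C) : CompactlyCoherentSpace (hPullback f g) :=
  inferInstanceAs (CompactlyCoherentSpace (CompactCoherentification
    {w : A × C(unitInterval, C) × B // w.2.1 0 = f w.1 ∧ w.2.1 1 = g w.2.2}))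

instance [CompactlyCoherentSpace A] [CompactlyCoherentSpace B] [CompactlyCoherentSpace P]
    (f : PtdMap P A) (g : PtdMap P B) : CompactlyCoherentSpace (hPushout f g) :=
  compactlyCoherentSpace_of_isQuotientMap (X := A ⊕ (P × I) ⊕ B)
    (q := Quot.mk (hPushoutRel f g)) isQuotientMap_quot_mk

instance [CompactlyCoherentSpace A] [CompactlyCoherentSpace B] (f : PtdMap A C)
    (g : PtdMap B C) : CompactlyCoherentSpace (join f g) :=
  inferInstanceAs (CompactlyCoherentSpace (hPushout (hPullback.fst f g) (hPullback.snd f g)))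

/-- A homotopy on a homotopy pushout from homotopies on its three pieces. -/
def hPushout.homotopyDesc {f : PtdMap P A} {g : PtdMap P B} {T : Type*} [TopologicalSpace T]
    (a : C(A × I, T)) (b : C(B × I, T)) (H : C((P × I) × I, T))
    (h0 : ∀ x s, H ((x, 0), s) = a (f x, s)) (h1 : ∀ x s, H ((x, 1), s) = b (g x, s))
    (hpt : ∀ t s, H ((P.pt, t), s) = H ((P.pt, 0), s)) : C(hPushout f g × I, T) where
  toFun q := Quot.lift (fun z : A ⊕ (P × I) ⊕ B =>
      Sum.elim (fun x => a (x, q.2)) (Sum.elim (fun y => H (y, q.2)) fun y => b (y, q.2)) z)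
    (by
      rintro _ _ (x | x | t)
      · exact h0 x q.2
      · exact h1 x q.2
      · exact hpt t q.2) q.1
  continuous_toFun := by
    refine IsQuotientMap.continuous_lift_prod_left
      (isQuotientMap_quot_mk (r := hPushoutRel f g)) ?_
    exact continuous_of_sum_prod a.continuous (continuous_of_sum_prod H.continuous b.continuous)

/-- Two homotopies with the same start, glued to a family of maps parametrized by the real line. -/
def glue {L T : Type*} [TopologicalSpace L] [TopologicalSpace T] (a b : C(L × I, T))
    (h : ∀ l, a (l, 0) = b (l, 0)) : C(L × ℝ, T) where
  toFun q := if q.2 ≤ 0 then a (q.1, clamp (-q.2)) else b (q.1, clamp q.2)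
  continuous_toFun := by
    refine Continuous.if_le (by fun_prop) (by fun_prop) (by fun_prop) (by fun_prop) ?_
    intro q hq
    rw [hq, neg_zero, clamp_of_nonpos le_rfl, h]

theorem glue_of_nonpos {L T : Type*} [TopologicalSpace L] [TopologicalSpace T]
    {a b : C(L × I, T)} (h : ∀ l, a (l, 0) = b (l, 0)) (l : L) {t : ℝ} (ht : t ≤ 0) :
    glue a b h (l, t) = a (l, clamp (-t)) := if_pos ht

theorem glue_of_nonneg {L T : Type*} [TopologicalSpace L] [TopologicalSpace T]
    {a b : C(L × I, T)} (h : ∀ l, a (l, 0) = b (l, 0)) (l : L) {t : ℝ} (ht : 0 ≤ t) :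
    glue a b h (l, t) = b (l, clamp t) := by
  rcases ht.eq_or_lt with rfl | ht
  · rw [glue_of_nonpos h l le_rfl, neg_zero, clamp_of_nonpos le_rfl, h]
  · exact if_neg ht.not_ge

theorem clamp_coe (t : I) : clamp (t : ℝ) = t := Set.projIcc_val zero_le_one t

/-- Contractions `N` of `u ∘ f` and `M` of `v ∘ g` combine to a deformation of `u × v` on the join
of `f × id` and `id × g` whose end has a coordinate in the end of `N` or of `M`. -/
theorem exists_join_deformation (f : PtdMap X Y) (g : PtdMap Z W) (u : PtdMap Y C)
    (v : PtdMap W D) (N : C(X × I, C)) (M : C(Z × I, D)) (hN0 : ∀ x, N (x, 0) = u (f x))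
    (hM0 : ∀ z, M (z, 0) = v (g z)) (hN : ∀ s, N (X.pt, s) = C.pt)
    (hM : ∀ s, M (Z.pt, s) = D.pt) :
    ∃ R : C(join (prodMap f (PtdMap.id W)) (prodMap (PtdMap.id Y) g) × I, prod C D),
      (∀ q, R (q, 0) =
        prodMap u v (joinMap (prodMap f (PtdMap.id W)) (prodMap (PtdMap.id Y) g) q)) ∧
      (∀ q, (∃ x, (prod.coords C D (R (q, 1))).1 = N (x, 1)) ∨
        ∃ z, (prod.coords C D (R (q, 1))).2 = M (z, 1)) ∧
      ∀ s, R ((join (prodMap f (PtdMap.id W)) (prodMap (PtdMap.id Y) g)).pt, s) =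
        (prod C D).pt := by
  set F := prodMap f (PtdMap.id W)
  set G := prodMap (PtdMap.id Y) g
  let l₀ : C(hPullback F G, X × W) := (prod.coords X W).comp (hPullback.fst F G).toMap
  let l₁ : C(hPullback F G, Y × Z) := (prod.coords Y Z).comp (hPullback.snd F G).toMap
  let γ : C(hPullback F G × I, Y × W) :=
    ⟨fun q => prod.coords Y W ((hPullback.triple F G q.1).1.2.1 q.2), by fun_prop⟩
  have hγ0 : ∀ l, γ (l, 0) = (f (l₀ l).1, (l₀ l).2) := fun l =>
    congrArg (prod.coords Y W) (hPullback.triple F G l).2.1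
  have hγ1 : ∀ l, γ (l, 1) = ((l₁ l).1, g (l₁ l).2) := fun l =>
    congrArg (prod.coords Y W) (hPullback.triple F G l).2.2
  have hγpt : ∀ t, γ ((hPullback F G).pt, t) = (Y.pt, W.pt) := fun t => rfl
  -- The first coordinate of the path starts at `f x`, where `N` prolongs it to negative times; it
  -- has reached the end of `N` at time `-1`. The second coordinate ends at `g z`, so `V` runs it
  -- backwards before prolonging it by `M`.
  let U : C(hPullback F G × ℝ, C) := glue
    ⟨fun q => N ((l₀ q.1).1, q.2), by fun_prop⟩ ⟨fun q => u (γ q).1, by fun_prop⟩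
    (fun l => by
      change N ((l₀ l).1, 0) = u (γ (l, 0)).1
      rw [hN0, hγ0])
  let V : C(hPullback F G × ℝ, D) := glue
    ⟨fun q => M ((l₁ q.1).2, q.2), by fun_prop⟩ ⟨fun q => v (γ (q.1, σ q.2)).2, by fun_prop⟩
    (fun l => by
      change M ((l₁ l).2, 0) = v (γ (l, σ 0)).2
      rw [hM0, unitInterval.symm_zero, hγ1])
  have hU_le : ∀ l (t : ℝ), t ≤ 0 → U (l, t) = N ((l₀ l).1, clamp (-t)) :=
    fun l t ht => glue_of_nonpos _ l ht
  have hU_ge : ∀ l (t : ℝ), 0 ≤ t → U (l, t) = u (γ (l, clamp t)).1 :=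
    fun l t ht => glue_of_nonneg _ l ht
  have hV_le : ∀ l (t : ℝ), t ≤ 0 → V (l, t) = M ((l₁ l).2, clamp (-t)) :=
    fun l t ht => glue_of_nonpos _ l ht
  have hV_ge : ∀ l (t : ℝ), 0 ≤ t → V (l, t) = v (γ (l, σ (clamp t))).2 :=
    fun l t ht => glue_of_nonneg _ l ht
  have hU_pt : ∀ t, U ((hPullback F G).pt, t) = C.pt := fun t => by
    rcases le_total t 0 with ht | ht
    · rw [hU_le _ _ ht]; exact hN _
    · rw [hU_ge _ _ ht, hγpt]; exact u.map_pt
  have hV_pt : ∀ t, V ((hPullback F G).pt, t) = D.pt := fun t => by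
    rcases le_total t 0 with ht | ht
    · rw [hV_le _ _ ht]; exact hM _
    · rw [hV_ge _ _ ht, hγpt]; exact v.map_pt
  -- The time of `U` is pulled back in proportion to `1 - t`, and in `R₂` that of `V` in proportion
  -- to `t`, so each coordinate stays fixed at the end of the cylinder where it need not be
  -- contractible. At `s = 1` the times are `4t - 3` and `1 - 4t`, and for every `t` one of them is
  -- at most `-1`; `3` is the least factor for which this holds at `t = 1/2`.
  let R₁ : C(join F G × I, C) := hPushout.homotopyDesc
    ⟨fun q => N ((prod.coords X W q.1).1, clamp (3 * q.2)), by fun_prop⟩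
    ⟨fun q => u (prod.coords Y Z q.1).1, by fun_prop⟩
    ⟨fun q => U (q.1.1, q.1.2 - 3 * q.2 * (1 - q.1.2)), by fun_prop⟩
    (fun l s => by
      change U (l, _) = N ((l₀ l).1, _)
      have hs : (0 : ℝ) ≤ s := s.2.1
      simp only [Set.Icc.coe_zero]
      rw [hU_le _ _ (by linarith)]
      congr 3; ring)
    (fun l s => by
      change U (l, _) = u (l₁ l).1
      simp only [Set.Icc.coe_one]
      rw [hU_ge _ _ (by linarith), clamp_of_one_le (by linarith), hγ1])
    (fun t s => (hU_pt _).trans (hU_pt _).symm)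
  let R₂ : C(join F G × I, D) := hPushout.homotopyDesc
    ⟨fun q => v (prod.coords X W q.1).2, by fun_prop⟩
    ⟨fun q => M ((prod.coords Y Z q.1).2, clamp (3 * q.2)), by fun_prop⟩
    ⟨fun q => V (q.1.1, 1 - q.1.2 - 3 * q.2 * q.1.2), by fun_prop⟩
    (fun l s => by
      change V (l, _) = v (l₀ l).2
      simp only [Set.Icc.coe_zero]
      rw [hV_ge _ _ (by linarith), clamp_of_one_le (by linarith), unitInterval.symm_one, hγ0])
    (fun l s => by
      change V (l, _) = M ((l₁ l).2, _)
      have hs : (0 : ℝ) ≤ s := s.2.1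
      simp only [Set.Icc.coe_one]
      rw [hV_le _ _ (by linarith)]
      congr 3; ring)
    (fun t s => (hV_pt _).trans (hV_pt _).symm)
  refine ⟨⟨fun q => CompactCoherentification.mk (C × D) (R₁ q, R₂ q),
    continuous_mk_of_continuous (by fun_prop)⟩, ?_, ?_, ?_⟩
  · intro q
    apply prod.coords_injective
    rw [prod.coords_prodMap]
    change (R₁ (q, 0), R₂ (q, 0)) = _
    obtain ⟨x | ⟨l, t⟩ | y, rfl⟩ := Quot.exists_rep q
    · refine Prod.ext ?_ ?_
      · change N ((prod.coords X W x).1, clamp (3 * (0 : I))) = u (f (prod.coords X W x).1)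
        rw [clamp_of_nonpos (by simp), hN0]
      · rfl
    · have ht := t.2
      refine Prod.ext ?_ ?_
      · change U (l, t - 3 * (0 : I) * (1 - t)) = u (γ (l, t)).1
        simp only [Set.Icc.coe_zero]
        rw [hU_ge _ _ (by linarith [ht.1])]
        simp [clamp_coe]
      · change V (l, 1 - t - 3 * (0 : I) * t) = v (γ (l, t)).2
        simp only [Set.Icc.coe_zero]
        rw [hV_ge _ _ (by linarith [ht.2])]
        have : (1 - (t : ℝ) - 3 * 0 * t) = (σ t : I) := by simp
        rw [this, clamp_coe, unitInterval.symm_symm]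
    · refine Prod.ext rfl ?_
      change M ((prod.coords Y Z y).2, clamp (3 * (0 : I))) = v (g (prod.coords Y Z y).2)
      rw [clamp_of_nonpos (by simp), hM0]
  · intro q
    change (∃ x, R₁ (q, 1) = N (x, 1)) ∨ ∃ z, R₂ (q, 1) = M (z, 1)
    obtain ⟨x | ⟨l, t⟩ | y, rfl⟩ := Quot.exists_rep q
    · refine Or.inl ⟨(prod.coords X W x).1, ?_⟩
      change N (_, clamp (3 * (1 : I))) = _
      rw [clamp_of_one_le (by norm_num)]
    · rcases le_total (t : ℝ) (1 / 2) with ht | ht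
      · refine Or.inl ⟨(l₀ l).1, ?_⟩
        change U (l, t - 3 * (1 : I) * (1 - t)) = _
        simp only [Set.Icc.coe_one]
        rw [hU_le _ _ (by linarith), clamp_of_one_le (by linarith)]
      · refine Or.inr ⟨(l₁ l).2, ?_⟩
        change V (l, 1 - t - 3 * (1 : I) * t) = _
        simp only [Set.Icc.coe_one]
        rw [hV_le _ _ (by linarith), clamp_of_one_le (by linarith)]
    · refine Or.inr ⟨(prod.coords Y Z y).2, ?_⟩
      change M (_, clamp (3 * (1 : I))) = _
      rw [clamp_of_one_le (by norm_num)]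
  · intro s
    apply prod.coords_injective
    exact Prod.ext (hN _) v.map_pt

end JoinContraction

/-! ### From the cofibre of the sectional fat wedge to the smash power. -/

section Cofibre

variable {E B : PtdSpace.{u}}

/-- The collapsed line over the base point of `E` joins the vertex to the base point of `B`. -/
theorem cofibre_mk_one (p : PtdMap E B) (e : E) :
    (Quot.mk _ (Sum.inr (Sum.inl (e, 1))) : cofibre p) = (cofibre p).pt := by
  have h : ∀ e : E, (Quot.mk _ (Sum.inr (Sum.inl (e, 1))) : cofibre p) =
      Quot.mk _ (Sum.inr (Sum.inr PUnit.unit)) := fun e => Quot.sound (.right e)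
  rw [h e, ← h E.pt]
  refine (Quot.sound (.base 1)).trans ((Quot.sound (.left E.pt)).trans ?_)
  exact congrArg (fun b => Quot.mk _ (Sum.inl b)) p.map_pt

theorem cofibre_mk_pt (p : PtdMap E B) (t : I) :
    (Quot.mk _ (Sum.inr (Sum.inl (E.pt, t))) : cofibre p) = (cofibre p).pt := by
  refine (Quot.sound (.base t)).trans ((Quot.sound (.left E.pt)).trans ?_)
  exact congrArg (fun b => Quot.mk _ (Sum.inl b)) p.map_pt

/-- The sectional fat wedge can be deformed into the fat wedge of the homotopy cofibre. -/
theorem exists_sectionalFatWedge_deformation (p : PtdMap E B) (n : ℕ) :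
    ∃ N : C((sectionalFatWedge p n).1 × I, pow (cofibre p) n),
      (∀ x, N (x, 0) = powMap (cofibreIncl p) n ((sectionalFatWedge p n).2 x)) ∧
      (∀ x, N (x, 1) ∈ fatWedge (cofibre p) n) ∧
      ∀ s, N ((sectionalFatWedge p n).1.pt, s) = (pow (cofibre p) n).pt := by
  let M : C(E × I, cofibre p) := ⟨fun q => Quot.mk _ (Sum.inr (Sum.inl q)),
    continuous_quot_mk.comp (continuous_inr.comp continuous_inl)⟩
  have hM0 : ∀ e, M (e, 0) = cofibreIncl p (p e) := fun e => Quot.sound (.left e)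
  induction n with
  | zero => exact ⟨M, hM0, cofibre_mk_one p, cofibre_mk_pt p⟩
  | succ n ih =>
    obtain ⟨N, hN0, hN1, hN⟩ := ih
    obtain ⟨R, hR0, hR1, hR⟩ := exists_join_deformation (sectionalFatWedge p n).2 p
      (powMap (cofibreIncl p) n) (cofibreIncl p) N M hN0 hM0 hN (cofibre_mk_pt p)
    refine ⟨R, hR0, fun q => ?_, hR⟩
    rcases hR1 q with ⟨x, hx⟩ | ⟨z, hz⟩
    · exact Or.inl ((congrArg (· ∈ fatWedge (cofibre p) n) hx).mpr (hN1 x))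
    · exact Or.inr (hz.trans (cofibre_mk_one p z))

theorem powMap_diag {X Y : PtdSpace.{u}} [CompactlyCoherentSpace X] [CompactlyCoherentSpace Y]
    (f : PtdMap X Y) (n : ℕ) (x : X) : powMap f n (diag X n x) = diag Y n (f x) := by
  induction n with
  | zero => rfl
  | succ n ih =>
    apply prod.coords_injective
    exact Prod.ext ih rfl

/-- If the diagonal is trivial in the cofibre of `κₙ`, then the reduced diagonal is trivial in the
smash power of the cofibre. -/
theorem nullHomotopic_smash_of_cofibre [CompactlyCoherentSpace B] (p : PtdMap E B) {n : ℕ}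
    (h : ((cofibreIncl (sectionalFatWedge p n).2).comp (diag B n)).NullHomotopic) :
    ((smashMap (cofibreIncl p) n).comp (reducedDiag B n)).NullHomotopic := by
  obtain ⟨N, hN0, hN1, hN⟩ := exists_sectionalFatWedge_deformation p n
  -- In the smash power the end of `N` is constant, so `N` extends the map over the cone on `κₙ`.
  let α : PtdMap (cofibre (sectionalFatWedge p n).2) (smash (cofibre p) n) :=
    hPushout.desc ((smashProj _ n).comp (powMap (cofibreIncl p) n))
      ⟨ContinuousMap.const _ (smash (cofibre p) n).pt, rfl⟩ ((smashProj _ n).toMap.comp N)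
      (fun x => congrArg _ (hN0 x))
      (fun x => Quot.sound ⟨hN1 x, by
        have := hN1 (sectionalFatWedge p n).1.pt
        rwa [hN] at this⟩)
      (fun t => congrArg _ (hN t))
  have hα : α.toMap.comp (ContinuousMap.const B (cofibre (sectionalFatWedge p n).2).pt) =
      ContinuousMap.const B (smash (cofibre p) n).pt :=
    ContinuousMap.ext fun _ => α.map_pt
  have hq := h.comp_continuousMap α.toMap
  rw [hα] at hq
  exact hq

end Cofibre

/-! ### The unreduced mapping cone, based at its vertex. -/

section Cone

variable {X Y : PtdSpace.{u}}

/-- The identifications that define the unreduced mapping cone of `f : X → Y`. -/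
inductive coneRel (f : PtdMap X Y) : Y ⊕ (X × I) → Y ⊕ (X × I) → Prop
  | bottom (x : X) : coneRel f (Sum.inr (x, 0)) (Sum.inl (f x))
  | top (x : X) : coneRel f (Sum.inr (x, 1)) (Sum.inr (X.pt, 1))

/-- The unreduced mapping cone of `f`, with the vertex as its base point. -/
def cone (f : PtdMap X Y) : PtdSpace.{u} :=
  ⟨Quot (coneRel f), Quot.mk _ (Sum.inr (X.pt, 1))⟩

/-- The quotient map onto the unreduced mapping cone. -/
def cone.mk (f : PtdMap X Y) : C(Y ⊕ (X × I), cone f) := ⟨Quot.mk _, continuous_quot_mk⟩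

theorem cone.isQuotientMap_mk (f : PtdMap X Y) : IsQuotientMap (cone.mk f) :=
  isQuotientMap_quot_mk (r := coneRel f)

theorem cone.mk_zero (f : PtdMap X Y) (x : X) :
    cone.mk f (Sum.inr (x, 0)) = cone.mk f (Sum.inl (f x)) := Quot.sound (.bottom x)

theorem cone.mk_one (f : PtdMap X Y) (x : X) :
    cone.mk f (Sum.inr (x, 1)) = (cone f).pt := Quot.sound (.top x)

/-- The inclusion of the target in the unreduced mapping cone. -/
def cone.incl (f : PtdMap X Y) : C(Y, cone f) := (cone.mk f).comp ⟨Sum.inl, continuous_inl⟩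

instance [CompactlyCoherentSpace X] [CompactlyCoherentSpace Y] (f : PtdMap X Y) :
    CompactlyCoherentSpace (cone f) :=
  compactlyCoherentSpace_of_isQuotientMap (cone.isQuotientMap_mk f)

/-- A map out of the unreduced mapping cone. -/
def cone.desc {T : Type*} [TopologicalSpace T] {f : PtdMap X Y} (u : C(Y, T)) (H : C(X × I, T))
    (h0 : ∀ x, H (x, 0) = u (f x)) (h1 : ∀ x, H (x, 1) = H (X.pt, 1)) : C(cone f, T) where
  toFun := Quot.lift (Sum.elim u H) (by
    rintro _ _ (x | x)
    · exact h0 x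
    · exact h1 x)
  continuous_toFun := continuous_quot_lift _ (u.continuous.sumElim H.continuous)

/-- The height of a point of the unreduced mapping cone. -/
def cone.height (f : PtdMap X Y) : C(cone f, I) :=
  cone.desc (ContinuousMap.const _ 0) ⟨Prod.snd, continuous_snd⟩ (fun _ => rfl) (fun _ => rfl)

/-- A subset of the unreduced mapping cone from compatible subsets of its two pieces. -/
def cone.glueSet (f : PtdMap X Y) (U : Set Y) (V : Set (X × I))
    (h0 : ∀ x, (x, 0) ∈ V ↔ f x ∈ U) (h1 : ∀ x, (x, 1) ∈ V ↔ (X.pt, 1) ∈ V) : Set (cone f) :=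
  Quot.lift (Sum.elim (· ∈ U) (· ∈ V)) (by
    rintro _ _ (x | x)
    · exact propext (h0 x)
    · exact propext (h1 x))

theorem cone.isOpen_glueSet {f : PtdMap X Y} {U : Set Y} {V : Set (X × I)}
    (h0 : ∀ x, (x, 0) ∈ V ↔ f x ∈ U) (h1 : ∀ x, (x, 1) ∈ V ↔ (X.pt, 1) ∈ V) (hU : IsOpen U)
    (hV : IsOpen V) : IsOpen (cone.glueSet f U V h0 h1) :=
  (cone.isQuotientMap_mk f).isOpen_preimage.1 (isOpen_sum_iff.2 ⟨hU, hV⟩)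

theorem cone.disjoint_glueSet {f : PtdMap X Y} {U U' : Set Y} {V V' : Set (X × I)}
    (h0 : ∀ x, (x, 0) ∈ V ↔ f x ∈ U) (h1 : ∀ x, (x, 1) ∈ V ↔ (X.pt, 1) ∈ V)
    (h0' : ∀ x, (x, 0) ∈ V' ↔ f x ∈ U') (h1' : ∀ x, (x, 1) ∈ V' ↔ (X.pt, 1) ∈ V')
    (hU : Disjoint U U') (hV : Disjoint V V') :
    Disjoint (cone.glueSet f U V h0 h1) (cone.glueSet f U' V' h0' h1') := by
  rw [Set.disjoint_left] at hU hV ⊢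
  intro z hz hz'
  obtain ⟨y | q, rfl⟩ := Quot.exists_rep z
  · exact hU hz hz'
  · exact hV hz hz'

theorem cone.exists_of_height_eq_zero {f : PtdMap X Y} {z : cone f}
    (h : cone.height f z = 0) : ∃ y, cone.incl f y = z := by
  obtain ⟨y | ⟨x, t⟩, rfl⟩ := Quot.exists_rep z
  · exact ⟨y, rfl⟩
  · obtain rfl : t = 0 := h
    exact ⟨f x, (cone.mk_zero f x).symm⟩

/-- Height separates points at different levels. At height `0`, disjoint open sets of `Y` are
thickened by their preimages below the vertex; strictly between `0` and `1`, disjoint open sets of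
`X` give open cylinders. This makes compact subsets of the cone locally compact, as the continuity
arguments on products require. -/
instance [T2Space X] [T2Space Y] (f : PtdMap X Y) : T2Space (cone f) := by
  refine ⟨fun z w hzw => ?_⟩
  by_cases hh : cone.height f z = cone.height f w
  · rcases eq_or_ne (cone.height f z) 0 with h0 | h0
    · obtain ⟨y, rfl⟩ := cone.exists_of_height_eq_zero h0
      obtain ⟨y', rfl⟩ := cone.exists_of_height_eq_zero (hh.symm.trans h0)
      obtain ⟨U, U', hU, hU', hy, hy', hd⟩ := t2_separation (ne_of_apply_ne (cone.incl f) hzw)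
      have hV : ∀ {U : Set Y}, IsOpen U → IsOpen {q : X × I | q.2 ≠ 1 ∧ f q.1 ∈ U} := fun hU =>
        (isOpen_ne.preimage continuous_snd).inter
          (hU.preimage (f.toMap.continuous.comp continuous_fst))
      exact ⟨cone.glueSet f U {q | q.2 ≠ 1 ∧ f q.1 ∈ U} (by simp) (by simp),
        cone.glueSet f U' {q | q.2 ≠ 1 ∧ f q.1 ∈ U'} (by simp) (by simp),
        cone.isOpen_glueSet _ _ hU (hV hU), cone.isOpen_glueSet _ _ hU' (hV hU'), hy, hy',
        cone.disjoint_glueSet _ _ _ _ hd (Set.disjoint_left.2 fun q hq hq' =>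
          Set.disjoint_left.1 hd hq.2 hq'.2)⟩
    · obtain ⟨y | ⟨x, t⟩, rfl⟩ := Quot.exists_rep z
      · exact absurd rfl h0
      obtain ⟨y | ⟨x', t'⟩, rfl⟩ := Quot.exists_rep w
      · exact absurd hh h0
      obtain rfl : t = t' := hh
      replace h0 : t ≠ 0 := h0
      have h1 : t ≠ 1 := by
        rintro rfl
        exact hzw ((cone.mk_one f x).trans (cone.mk_one f x').symm)
      have hx : x ≠ x' := by
        rintro rfl
        exact hzw rfl
      obtain ⟨U, U', hU, hU', hy, hy', hd⟩ := t2_separation hx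
      have hV : ∀ {U : Set X}, IsOpen U →
          IsOpen {q : X × I | q.2 ≠ 0 ∧ q.2 ≠ 1 ∧ q.1 ∈ U} := fun hU =>
        (isOpen_ne.preimage continuous_snd).inter
          ((isOpen_ne.preimage continuous_snd).inter (hU.preimage continuous_fst))
      exact ⟨cone.glueSet f ∅ {q | q.2 ≠ 0 ∧ q.2 ≠ 1 ∧ q.1 ∈ U} (by simp) (by simp),
        cone.glueSet f ∅ {q | q.2 ≠ 0 ∧ q.2 ≠ 1 ∧ q.1 ∈ U'} (by simp) (by simp),
        cone.isOpen_glueSet _ _ isOpen_empty (hV hU),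
        cone.isOpen_glueSet _ _ isOpen_empty (hV hU'), ⟨h0, h1, hy⟩, ⟨h0, h1, hy'⟩,
        cone.disjoint_glueSet _ _ _ _ disjoint_bot_left (Set.disjoint_left.2 fun q hq hq' =>
          Set.disjoint_left.1 hd hq.2.2 hq'.2.2)⟩
  · exact separated_by_continuous (cone.height f).continuous hh

end Cone

/-! ### Passing to the unreduced cone, and raising the smash power. -/

section Comparison

variable {E B : PtdSpace.{u}}

/-- For well-pointed spaces, the reduced mapping cone maps to the unreduced one, based at its
vertex, in a way that is compatible up to free homotopy with the inclusions of `B`. -/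
theorem exists_cofibre_to_cone [WellPointedCGH E] [WellPointedCGH B] (p : PtdMap E B) :
    ∃ θ : PtdMap (cofibre p) (cone p),
      (θ.comp (cofibreIncl p)).toMap.Homotopic (cone.incl p) := by
  -- The inclusion of `B` is dragged along the line over `E.pt` until the base point reaches the
  -- vertex.
  obtain ⟨H, hH0, hH⟩ := WellPointedCGH.hep (X := B) (cone p) (cone.incl p)
    ⟨fun t => cone.mk p (Sum.inr (E.pt, t)), by fun_prop⟩
    ((cone.mk_zero p E.pt).trans (congrArg (cone.incl p) p.map_pt))
  let u : PtdMap B (cone p) := ⟨⟨fun b => H (b, 1), by fun_prop⟩, hH 1⟩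
  have hu : u.toMap.Homotopic (cone.incl p) := ⟨{
    toFun q := H (q.2, σ q.1)
    continuous_toFun := by fun_prop
    map_zero_left b := by simp [u]
    map_one_left b := by simp [hH0] }⟩
  have hp : ((cone.incl p).comp p.toMap).Homotopic (ContinuousMap.const E (cone p).pt) := ⟨{
    toFun q := cone.mk p (Sum.inr (q.2, q.1))
    continuous_toFun := by fun_prop
    map_zero_left e := cone.mk_zero p e
    map_one_left e := cone.mk_one p e }⟩
  -- The map from the reduced cone needs a pointed contraction of `u ∘ p`. The cone supplies a free
  -- one, and well-pointedness of `E` corrects it.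
  obtain ⟨K⟩ := homotopicRel_const_of_homotopic (f := u.toMap.comp p.toMap) (y := (cone p).pt)
    ((congrArg u.toMap p.map_pt).trans u.map_pt)
    ((ContinuousMap.Homotopic.comp hu (.refl p.toMap)).trans hp)
  refine ⟨hPushout.desc u ⟨ContinuousMap.const _ (cone p).pt, rfl⟩
    ⟨fun q => K (q.2, q.1), by fun_prop⟩ (fun e => K.apply_zero e) (fun e => K.apply_one e)
    (fun t => K.eq_snd t rfl), hu⟩

theorem PtdMap.ext {X Y : PtdSpace.{u}} {f g : PtdMap X Y} (h : ∀ x, f x = g x) : f = g := by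
  cases f
  cases g
  congr
  exact ContinuousMap.ext h

theorem smashMap_comp_reducedDiag {X Y : PtdSpace.{u}} [CompactlyCoherentSpace X]
    [CompactlyCoherentSpace Y] (f : PtdMap X Y) (n : ℕ) :
    (smashMap f n).comp (reducedDiag X n) = (reducedDiag Y n).comp f :=
  PtdMap.ext fun x => congrArg (smashProj Y n) (powMap_diag f n x)

/-- If the reduced diagonal is trivial in the smash power of the cofibre, then it is freely
trivial in the smash power of the unreduced mapping cone. -/
theorem homotopic_const_of_nullHomotopic_smash [WellPointedCGH E] [WellPointedCGH B]
    (p : PtdMap E B) {n : ℕ}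
    (h : ((smashMap (cofibreIncl p) n).comp (reducedDiag B n)).NullHomotopic) :
    ((reducedDiag (cone p) n).toMap.comp (cone.incl p)).Homotopic
      (ContinuousMap.const B (smash (cone p) n).pt) := by
  obtain ⟨θ, hθ⟩ := exists_cofibre_to_cone p
  have : CompactlyCoherentSpace (cofibre p) := by
    have : CompactlyCoherentSpace point.{u} :=
      inferInstanceAs (CompactlyCoherentSpace PUnit.{u + 1})
    unfold cofibre
    infer_instance
  have h₁ := ContinuousMap.Homotopic.comp (.refl (smashMap θ n).toMap) h.homotopic
  have h₂ : (smashMap θ n).toMap.comp ((smashMap (cofibreIncl p) n).comp (reducedDiag B n)).toMap =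
      (reducedDiag (cone p) n).toMap.comp (θ.comp (cofibreIncl p)).toMap := by
    rw [smashMap_comp_reducedDiag]
    exact congrArg (fun g => g.toMap.comp (cofibreIncl p).toMap) (smashMap_comp_reducedDiag θ n)
  have h₃ : (smashMap θ n).toMap.comp (ContinuousMap.const B (smash (cofibre p) n).pt) =
      ContinuousMap.const B (smash (cone p) n).pt :=
    ContinuousMap.ext fun _ => (smashMap θ n).map_pt
  rw [h₂, h₃] at h₁
  exact (ContinuousMap.Homotopic.comp (.refl _) hθ).symm.trans h₁

instance (X : PtdSpace.{u}) [CompactlyCoherentSpace X] (n : ℕ) :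
    CompactlyCoherentSpace (pow X n) := by
  cases n
  · assumption
  · exact inferInstanceAs (CompactlyCoherentSpace (prod _ _))

instance (X Y : PtdSpace.{u}) [T2Space X] [T2Space Y] : T2Space (prod X Y) :=
  inferInstanceAs (T2Space (CompactCoherentification (X × Y)))

instance (X : PtdSpace.{u}) [T2Space X] (n : ℕ) : T2Space (pow X n) := by
  induction n with
  | zero => assumption
  | succ n _ => exact inferInstanceAs (T2Space (prod _ _))

/-- The point of the product with given coordinates. -/
def prod.mk {X Y : PtdSpace.{u}} (x : X) (y : Y) : prod X Y :=
  CompactCoherentification.mk (X × Y) (x, y)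

theorem prod.continuous_mk {X Y : PtdSpace.{u}} {T : Type*} [TopologicalSpace T]
    [CompactlyCoherentSpace T] {f : T → X} {g : T → Y} (hf : Continuous f) (hg : Continuous g) :
    Continuous fun t => prod.mk (f t) (g t) :=
  continuous_mk_of_continuous (hf.prodMk hg)

theorem pt_mem_fatWedge (X : PtdSpace.{u}) (n : ℕ) : (pow X n).pt ∈ fatWedge X n := by
  cases n
  · rfl
  · exact Or.inr rfl

/-- The map `X^[n+1] × X → X^[n+2]` on a Hausdorff compactly generated space `X`. -/
def smashAppend (X : PtdSpace.{u}) [T2Space X] [CompactlyCoherentSpace X] (n : ℕ) :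
    C(prod (smash X n) X, smash X (n + 1)) where
  toFun z := Quot.lift (fun a : pow X n =>
      (smashProj X (n + 1) (prod.mk a (prod.coords (smash X n) X z).2) : smash X (n + 1)))
    (fun _ _ h => Quot.sound ⟨Or.inl h.1, Or.inl h.2⟩) (prod.coords (smash X n) X z).1
  continuous_toFun := by
    -- A compact `K` in a Hausdorff space is locally compact, so the product of the smash projection
    -- with `K` is still a quotient map.
    refine continuous_of_forall_compact_right fun K hK => ?_
    have : CompactSpace K := isCompact_iff_compactSpace.1 hK
    refine IsQuotientMap.continuous_lift_prod_left
      (isQuotientMap_quot_mk (r := smashRel X n)) ?_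
    exact (smashProj X (n + 1)).toMap.continuous.comp
      (prod.continuous_mk (f := fun q : pow X n × K => q.1) (g := fun q => (q.2 : X))
        (by fun_prop) (by fun_prop))

/-- One more smash factor is added by pairing the contraction with the unchanged map `f`: once the
first factors reach the base point, so does the whole smash product. -/
theorem homotopic_const_reducedDiag_of_le {A X : PtdSpace.{u}} [T2Space X]
    [CompactlyCoherentSpace X] [CompactlyCoherentSpace A] (f : C(A, X)) {m n : ℕ} (hmn : m ≤ n)
    (h : ((reducedDiag X m).toMap.comp f).Homotopic (ContinuousMap.const A (smash X m).pt)) :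
    ((reducedDiag X n).toMap.comp f).Homotopic (ContinuousMap.const A (smash X n).pt) := by
  induction n, hmn using Nat.le_induction with
  | base => exact h
  | succ n _ ih =>
    obtain ⟨H⟩ := ih
    exact ⟨{
      toFun q := smashAppend X n (prod.mk (H q) (f q.2))
      continuous_toFun :=
        (smashAppend X n).continuous.comp (prod.continuous_mk (by fun_prop) (by fun_prop))
      map_zero_left a := by
        rw [H.apply_zero]; rfl
      map_one_left a := by
        rw [H.apply_one]
        exact Quot.sound ⟨Or.inl (pt_mem_fatWedge X n), Or.inl (pt_mem_fatWedge X n)⟩ }⟩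

end Comparison

/-! ### The product of two mapping cones maps to the cone of the join. -/

section ConeProduct

variable {X Y Z W : PtdSpace.{u}}

/-- The square `f x = f x`, `g z = g z` as a point of the homotopy pullback of `f × id` and
`id × g`, with a constant path. -/
def hPullback.ofConst (f : PtdMap X Y) (g : PtdMap Z W) :
    C(prod X Z, hPullback (prodMap f (PtdMap.id W)) (prodMap (PtdMap.id Y) g)) where
  toFun a := CompactCoherentification.mk _
    ⟨(prod.mk (prod.coords X Z a).1 (g (prod.coords X Z a).2),
      ContinuousMap.const I (prodMap f g a),
      prod.mk (f (prod.coords X Z a).1) (prod.coords X Z a).2), rfl, rfl⟩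
  continuous_toFun := by
    have h : Continuous fun a : prod X Z =>
        (prod.mk (prod.coords X Z a).1 (g (prod.coords X Z a).2),
          ContinuousMap.const I (prodMap f g a),
          prod.mk (f (prod.coords X Z a).1) (prod.coords X Z a).2) :=
      (prod.continuous_mk (by fun_prop) (by fun_prop)).prodMk
        ((ContinuousMap.continuous_const'.comp (prodMap f g).toMap.continuous).prodMk
          (prod.continuous_mk (by fun_prop) (by fun_prop)))
    exact continuous_mk_of_continuous (Y := {w : prod X W × C(I, prod Y W) × prod Y Z //
      w.2.1 0 = prodMap f (PtdMap.id W) w.1 ∧ w.2.1 1 = prodMap (PtdMap.id Y) g w.2.2})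
      (Continuous.subtype_mk h _)

/-- The join map of `f × id` and `id × g`. -/
abbrev prodJoin (f : PtdMap X Y) (g : PtdMap Z W) :
    PtdMap (join (prodMap f (PtdMap.id W)) (prodMap (PtdMap.id Y) g)) (prod Y W) :=
  joinMap (prodMap f (PtdMap.id W)) (prodMap (PtdMap.id Y) g)

/-- The map from the quotient presentation of a join. -/
def join.mk {A B C : PtdSpace.{u}} (f : PtdMap A C) (g : PtdMap B C) :
    C(A ⊕ (hPullback f g × I) ⊕ B, join f g) := ⟨Quot.mk _, continuous_quot_mk⟩

/-- The product of two unreduced mapping cones, mapped to the unreduced mapping cone of the join,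
on the level of representatives. -/
def coneProdAux (f : PtdMap X Y) (g : PtdMap Z W) :
    Y ⊕ (X × I) → W ⊕ (Z × I) → cone (prodJoin f g)
  | Sum.inl y, Sum.inl w => cone.mk _ (Sum.inl (prod.mk y w))
  | Sum.inr (x, s), Sum.inl w =>
    cone.mk _ (Sum.inr (join.mk _ _ (Sum.inl (prod.mk x w)), clamp (2 * s - 1)))
  | Sum.inl y, Sum.inr (z, s) =>
    cone.mk _ (Sum.inr (join.mk _ _ (Sum.inr (Sum.inr (prod.mk y z))), clamp (2 * s - 1)))
  -- The larger of the two heights, rescaled so that all of `[0, 1/2]` goes to `0`, is the new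
  -- height; the difference of the heights gives the position in the join. When one height is `0`
  -- and the other at least `1/2`, the position is clamped to the matching end of the cylinder. When
  -- both are at most `1/2`, the point lies in the bottom of the cone, where the constant path makes
  -- the position irrelevant.
  | Sum.inr (x, s), Sum.inr (z, t) =>
    cone.mk _ (Sum.inr (join.mk _ _ (Sum.inr (Sum.inl
      (hPullback.ofConst f g (prod.mk x z), clamp (t - s + 1 / 2)))),
        clamp (2 * max s t - 1)))

theorem coneProdAux_inr_one (f : PtdMap X Y) (g : PtdMap Z W) (x : X) (b : W ⊕ (Z × I)) :
    coneProdAux f g (Sum.inr (x, 1)) b = (cone (prodJoin f g)).pt := by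
  rcases b with w | ⟨z, t⟩
  · change cone.mk _ (Sum.inr (_, clamp (2 * ((1 : I) : ℝ) - 1))) = _
    rw [clamp_of_one_le (by norm_num), cone.mk_one]
  · change cone.mk _ (Sum.inr (_, clamp (2 * max ((1 : I) : ℝ) t - 1))) = _
    have h : (1 : ℝ) ≤ max ((1 : I) : ℝ) t := le_max_left _ _
    rw [clamp_of_one_le (t := 2 * max ((1 : I) : ℝ) t - 1) (by linarith), cone.mk_one]

theorem coneProdAux_one_inr (f : PtdMap X Y) (g : PtdMap Z W) (z : Z) (a : Y ⊕ (X × I)) :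
    coneProdAux f g a (Sum.inr (z, 1)) = (cone (prodJoin f g)).pt := by
  rcases a with y | ⟨x, s⟩
  · change cone.mk _ (Sum.inr (_, clamp (2 * ((1 : I) : ℝ) - 1))) = _
    rw [clamp_of_one_le (by norm_num), cone.mk_one]
  · change cone.mk _ (Sum.inr (_, clamp (2 * max (s : ℝ) (1 : I) - 1))) = _
    have h : (1 : ℝ) ≤ max (s : ℝ) (1 : I) := le_max_right _ _
    rw [clamp_of_one_le (t := 2 * max (s : ℝ) (1 : I) - 1) (by linarith), cone.mk_one]

theorem coneProdAux_inr_zero (f : PtdMap X Y) (g : PtdMap Z W) (x : X) (b : W ⊕ (Z × I)) :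
    coneProdAux f g (Sum.inr (x, 0)) b = coneProdAux f g (Sum.inl (f x)) b := by
  rcases b with w | ⟨z, t⟩
  · change cone.mk _ (Sum.inr (_, clamp (2 * ((0 : I) : ℝ) - 1))) = _
    rw [clamp_of_nonpos (by norm_num), cone.mk_zero]
    rfl
  · change cone.mk _ (Sum.inr (join.mk _ _ (Sum.inr (Sum.inl
      (hPullback.ofConst f g (prod.mk x z), clamp (t - (0 : I) + 1 / 2)))),
        clamp (2 * max ((0 : I) : ℝ) t - 1))) =
      cone.mk _ (Sum.inr (join.mk _ _ (Sum.inr (Sum.inr (prod.mk (f x) z))), clamp (2 * t - 1)))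
    have h : max ((0 : I) : ℝ) t = t := max_eq_right t.2.1
    rw [h]
    rcases le_total (t : ℝ) (1 / 2) with ht | ht
    · rw [clamp_of_nonpos (t := 2 * t - 1) (by linarith), cone.mk_zero, cone.mk_zero]
      rfl
    · simp only [Set.Icc.coe_zero]
      rw [clamp_of_one_le (t := t - 0 + 1 / 2) (by linarith)]
      exact congrArg (fun q => cone.mk _ (Sum.inr (q, clamp (2 * t - 1))))
        (Quot.sound (.right _))

theorem coneProdAux_zero_inr (f : PtdMap X Y) (g : PtdMap Z W) (z : Z) (a : Y ⊕ (X × I)) :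
    coneProdAux f g a (Sum.inr (z, 0)) = coneProdAux f g a (Sum.inl (g z)) := by
  rcases a with y | ⟨x, s⟩
  · change cone.mk _ (Sum.inr (_, clamp (2 * ((0 : I) : ℝ) - 1))) = _
    rw [clamp_of_nonpos (by norm_num), cone.mk_zero]
    rfl
  · change cone.mk _ (Sum.inr (join.mk _ _ (Sum.inr (Sum.inl
      (hPullback.ofConst f g (prod.mk x z), clamp ((0 : I) - s + 1 / 2)))),
        clamp (2 * max (s : ℝ) (0 : I) - 1))) =
      cone.mk _ (Sum.inr (join.mk _ _ (Sum.inl (prod.mk x (g z))), clamp (2 * s - 1)))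
    have h : max (s : ℝ) (0 : I) = s := max_eq_left s.2.1
    rw [h]
    rcases le_total (s : ℝ) (1 / 2) with hs | hs
    · rw [clamp_of_nonpos (t := 2 * s - 1) (by linarith), cone.mk_zero, cone.mk_zero]
      rfl
    · simp only [Set.Icc.coe_zero]
      rw [clamp_of_nonpos (t := 0 - s + 1 / 2) (by linarith)]
      exact congrArg (fun q => cone.mk _ (Sum.inr (q, clamp (2 * s - 1))))
        (Quot.sound (.left _))

/-- The product of two unreduced mapping cones, mapped to the unreduced mapping cone of the
join. -/
def coneProd (f : PtdMap X Y) (g : PtdMap Z W) : cone f → cone g → cone (prodJoin f g) :=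
  Quot.lift₂ (coneProdAux f g)
    (by
      rintro a _ _ (z | z)
      · exact coneProdAux_zero_inr f g z a
      · exact (coneProdAux_one_inr f g z a).trans (coneProdAux_one_inr f g _ a).symm)
    (by
      rintro _ _ b (x | x)
      · exact coneProdAux_inr_zero f g x b
      · exact (coneProdAux_inr_one f g x b).trans (coneProdAux_inr_one f g _ b).symm)

theorem coneProd_pt_left (f : PtdMap X Y) (g : PtdMap Z W) (c : cone g) :
    coneProd f g (cone f).pt c = (cone (prodJoin f g)).pt := by
  obtain ⟨b, rfl⟩ := (cone.isQuotientMap_mk g).surjective c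
  exact coneProdAux_inr_one f g _ b

theorem coneProd_pt_right (f : PtdMap X Y) (g : PtdMap Z W) (c : cone f) :
    coneProd f g c (cone g).pt = (cone (prodJoin f g)).pt := by
  obtain ⟨a, rfl⟩ := (cone.isQuotientMap_mk f).surjective c
  exact coneProdAux_one_inr f g _ a

/-- A map out of the product of an unreduced mapping cone and a Hausdorff space, in compactly
generated spaces, is continuous if it is so on the two pieces of the cone. -/
theorem cone.continuous_of_pieces {f : PtdMap X Y} {S T : Type*} [TopologicalSpace S] [T2Space S]
    [TopologicalSpace T] {h : cone f → S → T}
    (hl : ∀ K : Set S, IsCompact K → Continuous fun q : Y × K => h (cone.mk f (Sum.inl q.1)) q.2)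
    (hr : ∀ K : Set S, IsCompact K →
      Continuous fun q : (X × I) × K => h (cone.mk f (Sum.inr q.1)) q.2)
    {R : Type*} [TopologicalSpace R] [CompactlyCoherentSpace R] {φ : R → cone f} {ψ : R → S}
    (hφ : Continuous φ) (hψ : Continuous ψ) : Continuous fun r => h (φ r) (ψ r) := by
  let k : CompactCoherentification (cone f × S) → T := fun z =>
    h ((CompactCoherentification.mk _).symm z).1 ((CompactCoherentification.mk _).symm z).2
  have hk : Continuous k := by
    refine continuous_of_forall_compact_right fun K hK => ?_
    have : CompactSpace K := isCompact_iff_compactSpace.1 hK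
    refine IsQuotientMap.continuous_lift_prod_left (cone.isQuotientMap_mk f) ?_
    exact continuous_of_sum_prod (hl K hK) (hr K hK)
  exact hk.comp (continuous_mk_of_continuous (hφ.prodMk hψ))

variable [CompactlyCoherentSpace X] [CompactlyCoherentSpace Y]
  {R : Type*} [TopologicalSpace R] [CompactlyCoherentSpace R]

/-- The two cones are cut into pieces one at a time: here the second variable is already confined to
a piece of `cone g`. The arbitrary `φ` leaves room for a map that does not lift to the pieces of
`cone f`. -/
theorem continuous_coneProd_inl [T2Space W] (f : PtdMap X Y) (g : PtdMap Z W) {φ : R → cone f}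
    {ψ : R → W} (hφ : Continuous φ) (hψ : Continuous ψ) :
    Continuous fun r => coneProd f g (φ r) (cone.mk g (Sum.inl (ψ r))) := by
  refine cone.continuous_of_pieces (h := fun c w => coneProd f g c (cone.mk g (Sum.inl w)))
    (fun K hK => ?_) (fun K hK => ?_) hφ hψ
  all_goals have : CompactSpace K := isCompact_iff_compactSpace.1 hK
  · have h : Continuous fun q : Y × K => prod.mk q.1 (q.2 : W) :=
      prod.continuous_mk (by fun_prop) (by fun_prop)
    exact (cone.mk (prodJoin f g)).continuous.comp (continuous_inl.comp h)
  · have h : Continuous fun q : (X × I) × K => prod.mk q.1.1 (q.2 : W) :=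
      prod.continuous_mk (by fun_prop) (by fun_prop)
    exact (cone.mk (prodJoin f g)).continuous.comp (continuous_inr.comp
      (((join.mk _ _).continuous.comp (continuous_inl.comp h)).prodMk
        (g := fun q : (X × I) × K => clamp (2 * q.1.2 - 1)) (by fun_prop)))

theorem continuous_coneProd_inr [T2Space Z] (f : PtdMap X Y) (g : PtdMap Z W) {φ : R → cone f}
    {ψ : R → Z × I} (hφ : Continuous φ) (hψ : Continuous ψ) :
    Continuous fun r => coneProd f g (φ r) (cone.mk g (Sum.inr (ψ r))) := by
  refine cone.continuous_of_pieces (h := fun c w => coneProd f g c (cone.mk g (Sum.inr w)))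
    (fun K hK => ?_) (fun K hK => ?_) hφ hψ
  all_goals have : CompactSpace K := isCompact_iff_compactSpace.1 hK
  · have h : Continuous fun q : Y × K => prod.mk q.1 (q.2 : Z × I).1 :=
      prod.continuous_mk (by fun_prop) (by fun_prop)
    exact (cone.mk (prodJoin f g)).continuous.comp (continuous_inr.comp
      (((join.mk _ _).continuous.comp (continuous_inr.comp (continuous_inr.comp h))).prodMk
        (g := fun q : Y × K => clamp (2 * (q.2 : Z × I).2 - 1)) (by fun_prop)))
  · have h : Continuous fun q : (X × I) × K => prod.mk q.1.1 (q.2 : Z × I).1 :=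
      prod.continuous_mk (by fun_prop) (by fun_prop)
    exact (cone.mk (prodJoin f g)).continuous.comp (continuous_inr.comp
      (((join.mk _ _).continuous.comp (continuous_inr.comp (continuous_inl.comp
        (((hPullback.ofConst f g).continuous.comp h).prodMk
          (g := fun q : (X × I) × K => clamp ((q.2 : Z × I).2 - q.1.2 + 1 / 2))
            (by fun_prop))))).prodMk
        (g := fun q : (X × I) × K => clamp (2 * max (q.1.2 : ℝ) (q.2 : Z × I).2 - 1))
          (by fun_prop)))

/-- The map from `A × cone g` to the unreduced mapping cone of the join that a map `A → cone f`
induces. -/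
def coneProdMap {A : PtdSpace.{u}} [T2Space A] [T2Space Z] [T2Space W] [CompactlyCoherentSpace Z]
    [CompactlyCoherentSpace W] (f : PtdMap X Y) (g : PtdMap Z W) (F : C(A, cone f)) :
    C(prod A (cone g), cone (prodJoin f g)) where
  toFun z := coneProd f g (F (prod.coords A (cone g) z).1) (prod.coords A (cone g) z).2
  continuous_toFun := by
    -- Restricting `A` to a compact Hausdorff `K` keeps `cone g × K` a quotient of its pieces times
    -- `K`, and makes these compactly generated, as the two preceding lemmas require of `R`.
    refine continuous_of_forall_compact_left fun K hK => ?_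
    have : CompactSpace K := isCompact_iff_compactSpace.1 hK
    refine (IsQuotientMap.continuous_lift_prod_left (cone.isQuotientMap_mk g)
      (g := fun q : cone g × K => coneProd f g (F q.2) q.1) ?_).comp continuous_swap
    exact continuous_of_sum_prod
      (continuous_coneProd_inl f g (φ := fun q : W × K => F q.2) (by fun_prop) continuous_fst)
      (continuous_coneProd_inr f g (φ := fun q : (Z × I) × K => F q.2) (by fun_prop)
        continuous_fst)

end ConeProduct

/-! ### From the smash power to the cofibre of the sectional fat wedge, and the conclusion. -/

section Main

variable {E B : PtdSpace.{u}}

instance [CompactlyCoherentSpace E] [CompactlyCoherentSpace B] (p : PtdMap E B) (n : ℕ) :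
    CompactlyCoherentSpace (sectionalFatWedge p n).1 := by
  cases n with
  | zero => assumption
  | succ n =>
    exact inferInstanceAs (CompactlyCoherentSpace (join
      (prodMap (sectionalFatWedge p n).2 (PtdMap.id B)) (prodMap (PtdMap.id (pow B n)) p)))

/-- The power of the unreduced mapping cone of `p` maps to the unreduced mapping cone of `κₙ`. -/
theorem exists_pow_cone_to_cone [T2Space E] [T2Space B] [CompactlyCoherentSpace E]
    [CompactlyCoherentSpace B] (p : PtdMap E B) (n : ℕ) :
    ∃ F : C(pow (cone p) n, cone (sectionalFatWedge p n).2),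
      (∀ a ∈ fatWedge (cone p) n, F a = (cone (sectionalFatWedge p n).2).pt) ∧
      ∀ b, F (diag (cone p) n (cone.incl p b)) =
        cone.incl (sectionalFatWedge p n).2 (diag B n b) := by
  induction n with
  -- The one-fold fat wedge is just the base point, here the vertex, and `κ₀ = p`.
  | zero => exact ⟨ContinuousMap.id _, fun a ha => ha, fun b => rfl⟩
  | succ n ih =>
    obtain ⟨F, hF, hFb⟩ := ih
    refine ⟨coneProdMap (sectionalFatWedge p n).2 p F, fun a ha => ?_, fun b => ?_⟩
    · change coneProd _ p (F _) _ = _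
      rcases ha with ha | ha
      · rw [hF _ ha]
        exact coneProd_pt_left _ _ _
      · exact (congrArg (coneProd _ p _) ha).trans (coneProd_pt_right _ _ _)
    · change coneProd _ p (F (diag (cone p) n (cone.incl p b))) (cone.incl p b) = _
      rw [hFb]
      rfl

/-- The quotient map from the unreduced to the reduced mapping cone. -/
def coneToCofibre {X Y : PtdSpace.{u}} (f : PtdMap X Y) : C(cone f, cofibre f) :=
  cone.desc (cofibreIncl f).toMap
    ⟨fun q => Quot.mk _ (Sum.inr (Sum.inl q)),
      continuous_quot_mk.comp (continuous_inr.comp continuous_inl)⟩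
    (fun x => Quot.sound (.left x))
    (fun x => (cofibre_mk_one f x).trans (cofibre_mk_one f X.pt).symm)

/-- If the reduced diagonal is freely trivial in the smash power of the unreduced mapping cone,
then the diagonal is trivial in the cofibre of `κₙ`. -/
theorem nullHomotopic_cofibre_of_homotopic_const [T2Space E] [CompactlyCoherentSpace E]
    [WellPointedCGH B] (p : PtdMap E B) {n : ℕ}
    (h : ((reducedDiag (cone p) n).toMap.comp (cone.incl p)).Homotopic
      (ContinuousMap.const B (smash (cone p) n).pt)) :
    ((cofibreIncl (sectionalFatWedge p n).2).comp (diag B n)).NullHomotopic := by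
  obtain ⟨F, hF, hFb⟩ := exists_pow_cone_to_cone p n
  refine homotopicRel_const_of_homotopic
    ((cofibreIncl (sectionalFatWedge p n).2).comp (diag B n)).map_pt ?_
  let q := coneToCofibre (sectionalFatWedge p n).2
  -- `F` is constant on the fat wedge, so it descends to the smash power; the reduction `q` then
  -- takes the vertex to the base point.
  let β : C(smash (cone p) n, cofibre (sectionalFatWedge p n).2) :=
    ⟨Quot.lift (fun a => q (F a)) fun a b hab => by rw [hF a hab.1, hF b hab.2],
      continuous_quot_lift _ (q.continuous.comp F.continuous)⟩
  have hq := ContinuousMap.Homotopic.comp (.refl β) h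
  have h₁ : β.comp ((reducedDiag (cone p) n).toMap.comp (cone.incl p)) =
      ((cofibreIncl (sectionalFatWedge p n).2).comp (diag B n)).toMap :=
    ContinuousMap.ext fun b => congrArg q (hFb b)
  have h₂ : β.comp (ContinuousMap.const B (smash (cone p) n).pt) =
      ContinuousMap.const B (cofibre (sectionalFatWedge p n).2).pt :=
    ContinuousMap.ext fun b => (congrArg q (hF _ (pt_mem_fatWedge (cone p) n))).trans
      (cofibre_mk_one _ _)
  rwa [h₁, h₂] at hq

end Main

end WeakSecat

end

theorem mainTheorem6 (E B : WeakSecat.PtdSpace.{u}) [WeakSecat.WellPointedCGH E]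
    [WeakSecat.WellPointedCGH B] (p : WeakSecat.PtdMap E B) (n : ℕ) :
    WeakSecat.wsecat p ≤ n ↔
      ((WeakSecat.smashMap (WeakSecat.cofibreIncl p) n).comp
        (WeakSecat.reducedDiag B n)).NullHomotopic := by
  constructor
  · intro h
    -- The infimum of the empty set is `⊤`, so the bound by `n` forces the set to be nonempty, and
    -- the infimum is attained.
    have hne : {m : ℕ∞ | ∃ k : ℕ, m = k ∧ ((WeakSecat.cofibreIncl
        (WeakSecat.sectionalFatWedge p k).2).comp (WeakSecat.diag B k)).NullHomotopic}.Nonempty := by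
      by_contra hne
      rw [WeakSecat.wsecat, Set.not_nonempty_iff_eq_empty.1 hne, sInf_empty] at h
      exact absurd h (by simp)
    obtain ⟨m, hm, hnull⟩ := csInf_mem hne
    have hmn : m ≤ n := by
      have hq : ((m : ℕ) : ℕ∞) ≤ n := hm ▸ h
      exact_mod_cast hq
    -- The least index `m` may be smaller than `n`. The contraction is carried to the smash power of
    -- the unreduced cone, raised there from `m` to `n`, and carried back through the cofibre of
    -- `κₙ`.
    exact WeakSecat.nullHomotopic_smash_of_cofibre p
      (WeakSecat.nullHomotopic_cofibre_of_homotopic_const p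
        (WeakSecat.homotopic_const_reducedDiag_of_le _ hmn
          (WeakSecat.homotopic_const_of_nullHomotopic_smash p
            (WeakSecat.nullHomotopic_smash_of_cofibre p hnull))))
  · intro h
    exact sInf_le ⟨n, rfl, WeakSecat.nullHomotopic_cofibre_of_homotopic_const p
      (WeakSecat.homotopic_const_of_nullHomotopic_smash p h)⟩
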